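/- Let $m\ge 0$ be fixed, let $0<\theta_1<\dots<\theta_m<1$ be fixed, and let $\mu_1,\dots,\mu_{m+1}\in\mathbb R$ with $\mu_k\neq\mu_{k+1}$ for $1\le k\le m$. For each $n$ put $\tau_i=\lfloor\theta_i n\rfloor$ for $1\le i\le m$, $\tau_0=0$, $\tau_{m+1}=n$, and let $$Y_i=\mu_k+Z_i\qquad(\tau_{k-1}<i\le\tau_k,\ 1\le k\le m+1),$$ where $Z_1,\dots,Z_n$ are independent $N(0,\sigma^2)$ random variables with fixed $\sigma^2>0$. Given a penalty $\beta$ and a candidate set $\mathcal B\subseteq\{1,\dots,n-1\}$, let $\mathrm{PELT}(Y_{1:n},\mathcal B)$ be a set $\{t_1<\dots<t_k\}\subseteq\mathcal B$ (with $k\ge0$ not fixed) that minimises, among all subsets of $\mathcal B$, the penalised squared error cost $$\sum_{i=1}^{k+1}\Big[\sum_{j=t_{i-1}+1}^{t_i}\big(Y_j-\bar Y_{t_{i-1}+1:t_i}\big)^2+\beta\Big],\qquad t_0=0,\ t_{k+1}=n,$$ where $\bar Y_{s:t}$ is the mean of $Y_s,\dots,Y_t$. The Deal procedure with $L(n)$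 cores gives core $k\in\{1,\dots,L(n)\}$ the candidates $\mathcal B_k=\{t\in\{1,\dots,n-1\}: t\equiv k \bmod L(n)\}$, computes $\hat{\boldsymbol\tau}_k=\mathrm{PELT}(Y_{1:n},\mathcal B_k)$ for each $k$, and returns $\{\hat\tau_1<\dots<\hat\tau_{\hat m}\}=\mathrm{PELT}\big(Y_{1:n},\bigcup_{k=1}^{L(n)}\hat{\boldsymbol\tau}_k\big)$. Let $\epsilon>0$ and $\alpha>0$, and use the penalty $\beta=(2+\epsilon)\,\sigma^2\log n$ throughout (so $\beta=(2+\epsilon)\log n$ for noise of unit variance). Assume that $L(n)=o(n)$ and that $L(n)\ge\lceil(\log n)^{1+\alpha}\rceil$ for all large $n$. Then, however ties between minimisers are broken, $\mathbb P(\mathcal E_n^\alpha)\to1$ as $n\to\infty$, where $$\mathcal E_n^\alpha=\Big\{\hat m=m\ ;\ \max_{i=1,\dots,m}|\hat\tau_i-\tau_i|\le\big\lceil(\log n)^{1+\alpha}\big\rceil\Big\}.$$ -/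

import Mathlib

open Filter Topology MeasureTheory ProbabilityTheory Asymptotics

noncomputable section

namespace Changepoint

/-- The quadratic error loss of the data segment `y (s+1), …, y t`: the sum of the squared
deviations from the segment mean (an empty segment has cost `0`). -/
def segmentCost (y : ℕ → ℝ) (s t : ℕ) : ℝ :=
  ∑ i ∈ Finset.Ioc s t, (y i - (∑ j ∈ Finset.Ioc s t, y j) / ((t : ℝ) - s)) ^ 2

/-- The end point of the segment preceding the one that ends at `t`: the largest changepoint of
`S` below `t`, or `0` if there is none. -/
def prevChange (S : Finset ℕ) (t : ℕ) : ℕ := (S.filter (· < t)).sup id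

/-- The penalised cost of segmenting `y 1, …, y n` at the changepoints `S ⊆ {1, …, n - 1}`: the
segments end at the points of `S` and at `n`, and each contributes its quadratic error loss
plus the penalty `β`. -/
def penalisedCost (y : ℕ → ℝ) (n : ℕ) (β : ℝ) (S : Finset ℕ) : ℝ :=
  ∑ t ∈ insert n S, (segmentCost y (prevChange S t) t + β)

/-- `S` is a possible result of `PELT(y_{1:n}, B)`: an exact minimiser of the penalised cost
among all sets of changepoints contained in the candidate set `B`. -/
def IsPelt (y : ℕ → ℝ) (n : ℕ) (β : ℝ) (B S : Finset ℕ) : Prop :=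
  S ⊆ B ∧ ∀ T ⊆ B, penalisedCost y n β S ≤ penalisedCost y n β T

/-- The candidates `k, L + k, 2 L + k, …` below `n` that are dealt to core `k ∈ {1, …, L}`. -/
def dealt (n L k : ℕ) : Finset ℕ :=
  (Finset.Icc 1 (n - 1)).filter (fun t => t % L = k % L)

/-- `S` is a possible result of the Deal procedure with `L` cores: each core `k` returns a
result `C k` of PELT on all the data with the candidates dealt to it, and `S` is a result of PELT
on all the data with candidate set `C 1 ∪ ⋯ ∪ C L`. -/
def IsDealOutput (y : ℕ → ℝ) (n L : ℕ) (β : ℝ) (S : Finset ℕ) : Prop :=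
  ∃ C : ℕ → Finset ℕ,
    (∀ k ∈ Finset.Icc 1 L, IsPelt y n β (dealt n L k) (C k)) ∧
      IsPelt y n β ((Finset.Icc 1 L).biUnion C) S

/-- The true changepoint `⌊θ_j n⌋`. -/
def changeLoc {m : ℕ} (θ : Fin m → ℝ) (n : ℕ) (j : Fin m) : ℕ := ⌊θ j * n⌋₊

/-- The (zero-based) number of the true segment that contains time `i`: the number of true
changepoints strictly before `i`. -/
def segmentIndex {m : ℕ} (θ : Fin m → ℝ) (n i : ℕ) : Fin (m + 1) :=
  ⟨(Finset.univ.filter (fun j : Fin m => changeLoc θ n j < i)).card,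
    Nat.lt_succ_of_le ((Finset.card_le_univ _).trans_eq (Fintype.card_fin m))⟩

/-- The change in mean model: the noise plus a piecewise constant mean with values `μ`. -/
def changeInMean {m : ℕ} (θ : Fin m → ℝ) (μ : Fin (m + 1) → ℝ) (n : ℕ) (noise : ℕ → ℝ) :
    ℕ → ℝ :=
  fun i => noise i + μ (segmentIndex θ n i)

/-- The estimated set `S` has exactly `m` changepoints, and in increasing order they are within
`⌈(log n) ^ (1 + α)⌉` of the respective true changepoints. -/
def Accurate {m : ℕ} (θ : Fin m → ℝ) (α : ℝ) (n : ℕ) (S : Finset ℕ) : Prop :=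
  ∃ h : S.card = m, ∀ j : Fin m,
    |((S.orderEmbOfFin h j : ℕ) : ℤ) - (changeLoc θ n j : ℤ)| ≤
      (⌈Real.log n ^ (1 + α)⌉₊ : ℤ)

theorem exists_isPelt (y : ℕ → ℝ) (n : ℕ) (β : ℝ) (B : Finset ℕ) : ∃ S, IsPelt y n β B S := by
  obtain ⟨S, hS, hmin⟩ :=
    B.powerset.exists_min_image (penalisedCost y n β) ⟨∅, Finset.empty_mem_powerset B⟩
  exact ⟨S, Finset.mem_powerset.1 hS, fun T hT => hmin T (Finset.mem_powerset.2 hT)⟩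

/-- The Deal procedure always has a result. -/
theorem exists_isDealOutput (y : ℕ → ℝ) (n L : ℕ) (β : ℝ) : ∃ S, IsDealOutput y n L β S := by
  choose C hC using fun k => exists_isPelt y n β (dealt n L k)
  obtain ⟨S, hS⟩ := exists_isPelt y n β ((Finset.Icc 1 L).biUnion C)
  exact ⟨S, C, fun k _ => hC k, hS⟩

end Changepoint

end

/-! The cost of a segmentation is the total sum of squares minus the energy explained by its block
means, and refining a segmentation never raises its cost. A segmentation containing every true
changepoint does not see the signal, so its cost is that of the noise alone. Hence any set `S` can
be bounded below by adding the true changepoints to it, and a minimiser can be bounded above by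
comparison with the true segmentation (`cost_le_of_isPelt`).

All the probability is in one event, `GoodNoise`: adding `k ≥ 1` arbitrary points to the true
changepoints, and to one free companion within `w` of each, leaves the total noise energy below `k *
β`. The block energies divided by `v` are independent chi-squared variables, so Chernoff's bound at
an order `r < 1/2` with `r * (2 + ε) > 1` beats the at most `n ^ k` choices of the added points. The
companions have at most `(2 * w + 1) ^ m` positions, a power of a logarithm, which is why they need
not be charged.

On this event the rest is deterministic. Splitting at a true changepoint with clean windows of
length `r` on both sides gains at least `r * δ ^ 2 / 4 - 2 * β`, where `δ` is the smallest jump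
(`gain_lower_bound`). With `r = L` it makes the core that holds a true changepoint keep it
(`mem_of_isPelt_dealt`). The true changepoints are thus candidates of the final run, and `r = w`
gives an estimate within `w` of each (`exists_close_of_isPelt`). With these estimates as companions,
every surplus estimate costs more penalty than it can explain (`accurate_of_isPelt`). -/

namespace Changepoint

/-! ### Sums over segments and their behaviour under refinement. -/

section Segmentation

/-- The sum of `h a b` over the segments `(a, b]` into which `S` divides `(0, n]`. -/
noncomputable def segSum (h : ℕ → ℕ → ℝ) (n : ℕ) (S : Finset ℕ) : ℝ :=
  ∑ t ∈ insert n S, h (prevChange S t) t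

theorem prevChange_le (S : Finset ℕ) (t : ℕ) : prevChange S t ≤ t :=
  Finset.sup_le fun _ hs => (Finset.mem_filter.1 hs).2.le

theorem le_prevChange {S : Finset ℕ} {s t : ℕ} (hs : s ∈ S) (hst : s < t) :
    s ≤ prevChange S t :=
  Finset.le_sup (f := id) (Finset.mem_filter.2 ⟨hs, hst⟩)

theorem prevChange_eq {S : Finset ℕ} {a t : ℕ} (ha : a = 0 ∨ a ∈ S) (hat : a < t)
    (h : ∀ s ∈ S, s < t → s ≤ a) : prevChange S t = a := by
  apply le_antisymm
  · exact Finset.sup_le fun s hs => h s (Finset.mem_filter.1 hs).1 (Finset.mem_filter.1 hs).2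
  · rcases ha with rfl | ha
    · exact Nat.zero_le _
    · exact le_prevChange ha hat

theorem prevChange_spec (S : Finset ℕ) {t : ℕ} (ht : 0 < t) :
    (prevChange S t = 0 ∨ prevChange S t ∈ S) ∧ prevChange S t < t := by
  rcases (S.filter (· < t)).eq_empty_or_nonempty with h | h
  · simp [prevChange, h, ht]
  · obtain ⟨x, hx, hxe⟩ := Finset.exists_mem_eq_sup _ h id
    have := Finset.mem_filter.1 hx
    have e : prevChange S t = x := hxe
    rw [e]
    exact ⟨Or.inr this.1, this.2⟩

theorem prevChange_lt (S : Finset ℕ) {t : ℕ} (ht : 0 < t) : prevChange S t < t :=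
  (prevChange_spec S ht).2

theorem segSum_empty (h : ℕ → ℕ → ℝ) (n : ℕ) : segSum h n ∅ = h 0 n := by
  simp [segSum, prevChange]

theorem penalisedCost_eq (y : ℕ → ℝ) {n : ℕ} (β : ℝ) {S : Finset ℕ} (hS : ∀ s ∈ S, s < n) :
    penalisedCost y n β S = segSum (segmentCost y) n S + (S.card + 1) * β := by
  have : n ∉ S := fun h => (hS n h).false
  simp [penalisedCost, segSum, Finset.sum_add_distrib, Finset.card_insert_of_notMem this]

/-- Only `t` and the next end point `b` are affected: `b` acquires the predecessor `t`, and `t`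
takes over the former predecessor of `b`. -/
theorem segSum_insert_of_next (h : ℕ → ℕ → ℝ) {n : ℕ} {S : Finset ℕ} (hS : ∀ s ∈ S, s < n)
    {t b : ℕ} (ht : t ∉ S) (ht0 : 0 < t) (hb : b ∈ insert n S) (htb : t < b)
    (hnext : ∀ x ∈ insert n S, t < x → b ≤ x) :
    segSum h n (insert t S) + h (prevChange S t) b =
      segSum h n S + h (prevChange S t) t + h t b := by
  have hSn : ∀ x ∈ insert n S, x ≤ n := fun x hx => by
    rcases Finset.mem_insert.1 hx with rfl | hx
    · rfl
    · exact (hS x hx).le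
  have htn : t < n := htb.trans_le (hSn b hb)
  have htS : t ∉ insert n S := by simp [ht, htn.ne]
  have key : ∀ x ∈ (insert n S).erase b, prevChange (insert t S) x = prevChange S x := by
    intro x hx
    obtain ⟨hxb, hx⟩ := Finset.mem_erase.1 hx
    rcases Nat.eq_zero_or_pos x with rfl | hx0
    · simp [prevChange]
    refine prevChange_eq ?_ (prevChange_lt S hx0) ?_
    · exact (prevChange_spec S hx0).1.imp_right (Finset.mem_insert_of_mem ·)
    · intro s hs hsx
      rcases Finset.mem_insert.1 hs with rfl | hs
      · have h1 : b < x := lt_of_le_of_ne (hnext x hx hsx) (Ne.symm hxb)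
        have h2 : b ∈ S := by
          rcases Finset.mem_insert.1 hb with rfl | hb
          · exact absurd (hSn x hx) (not_le.2 h1)
          · exact hb
        exact htb.le.trans (le_prevChange h2 h1)
      · exact le_prevChange hs hsx
  have ht1 : prevChange (insert t S) t = prevChange S t := by
    simp [prevChange, Finset.filter_insert]
  have hb1 : prevChange (insert t S) b = t :=
    prevChange_eq (Or.inr (Finset.mem_insert_self _ _)) htb fun s hs hsb => by
      rcases Finset.mem_insert.1 hs with rfl | hs
      · rfl
      · by_contra hts
        exact absurd (hnext s (Finset.mem_insert_of_mem hs) (not_le.1 hts)) (not_le.2 hsb)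
  have hb2 : prevChange S b = prevChange S t :=
    prevChange_eq (prevChange_spec S ht0).1 ((prevChange_lt S ht0).trans htb) fun s hs hsb => by
      refine le_prevChange hs (lt_of_not_ge fun hts => ?_)
      have h1 : t < s := lt_of_le_of_ne hts fun e => ht (e ▸ hs)
      exact absurd (hnext s (Finset.mem_insert_of_mem hs) h1) (not_le.2 hsb)
  have e1 : segSum h n S = h (prevChange S t) b +
      ∑ x ∈ (insert n S).erase b, h (prevChange S x) x := by
    rw [segSum, ← Finset.add_sum_erase _ _ hb, hb2]
  have e2 : segSum h n (insert t S) = h (prevChange S t) t + (h t b +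
      ∑ x ∈ (insert n S).erase b, h (prevChange S x) x) := by
    rw [segSum, Finset.insert_comm, Finset.sum_insert htS, ht1, ← Finset.add_sum_erase _ _ hb,
      hb1, Finset.sum_congr rfl fun x hx => by rw [key x hx]]
  rw [e1, e2]
  ring

theorem exists_next {n : ℕ} (S : Finset ℕ) {t : ℕ} (htn : t < n) :
    ∃ b ∈ insert n S, t < b ∧ ∀ x ∈ insert n S, t < x → b ≤ x := by
  have hne : ((insert n S).filter (t < ·)).Nonempty :=
    ⟨n, Finset.mem_filter.2 ⟨Finset.mem_insert_self _ _, htn⟩⟩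
  have hm := Finset.mem_filter.1 (Finset.min'_mem _ hne)
  exact ⟨_, hm.1, hm.2, fun x hx htx => Finset.min'_le _ _ (Finset.mem_filter.2 ⟨hx, htx⟩)⟩

theorem segSum_union_le {h : ℕ → ℕ → ℝ}
    (hsup : ∀ a t b, a ≤ t → t ≤ b → h a t + h t b ≤ h a b)
    {n : ℕ} {S : Finset ℕ} (hS : ∀ s ∈ S, 0 < s ∧ s < n) (R : Finset ℕ)
    (hR : ∀ s ∈ R, 0 < s ∧ s < n) : segSum h n (S ∪ R) ≤ segSum h n S := by
  induction R using Finset.induction_on with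
  | empty => simp
  | insert t R _ ih =>
    have ih := ih fun s hs => hR s (Finset.mem_insert_of_mem hs)
    have ht := hR t (Finset.mem_insert_self _ _)
    rw [Finset.union_insert]
    by_cases htm : t ∈ S ∪ R
    · rwa [Finset.insert_eq_of_mem htm]
    obtain ⟨b, hb, htb, hnext⟩ := exists_next (S ∪ R) ht.2
    have h1 := segSum_insert_of_next h (S := S ∪ R) (fun s hs => by
      rcases Finset.mem_union.1 hs with hs | hs
      · exact (hS s hs).2
      · exact (hR s (Finset.mem_insert_of_mem hs)).2) htm ht.1 hb htb hnext
    have h2 := hsup (prevChange (S ∪ R) t) t b (prevChange_le _ _) htb.le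
    linarith

theorem segSum_mono_of_subset {h : ℕ → ℕ → ℝ}
    (hsup : ∀ a t b, a ≤ t → t ≤ b → h a t + h t b ≤ h a b)
    {n : ℕ} {S T : Finset ℕ} (hST : S ⊆ T) (hT : ∀ s ∈ T, 0 < s ∧ s < n) :
    segSum h n T ≤ segSum h n S := by
  simpa [Finset.union_eq_right.2 hST] using
    segSum_union_le hsup (fun s hs => hT s (hST hs)) T hT

/-- Additivity is superadditivity of both `h` and `-h`, so comparison with the empty segmentation
gives both inequalities. -/
theorem segSum_of_additive {h : ℕ → ℕ → ℝ}
    (hadd : ∀ a t b, a ≤ t → t ≤ b → h a t + h t b = h a b)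
    {n : ℕ} {S : Finset ℕ} (hS : ∀ s ∈ S, 0 < s ∧ s < n) : segSum h n S = h 0 n := by
  rw [← segSum_empty h n]
  apply le_antisymm
  · exact segSum_mono_of_subset (fun a t b h1 h2 => (hadd a t b h1 h2).le)
      (Finset.empty_subset S) hS
  · have := segSum_mono_of_subset (h := fun a b => -h a b) (fun a t b h1 h2 => by
      have := hadd a t b h1 h2
      linarith) (Finset.empty_subset S) hS
    simpa [segSum, Finset.sum_neg_distrib] using this

/-- Removing the last changepoint splits off the last segment. -/
theorem segSum_insert_last (h : ℕ → ℕ → ℝ) {n t : ℕ} {S : Finset ℕ} (hS : ∀ s ∈ S, s < t)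
    (htn : t < n) : segSum h n (insert t S) = segSum h t S + h t n := by
  have hn : n ∉ insert t S := by
    rw [Finset.mem_insert]
    rintro (h1 | h1)
    · omega
    · have := hS n h1; omega
  have hpn : prevChange (insert t S) n = t :=
    prevChange_eq (Or.inr (Finset.mem_insert_self _ _)) htn fun s hs _ => by
      rcases Finset.mem_insert.1 hs with rfl | hs
      · rfl
      · exact (hS s hs).le
  rw [segSum, Finset.sum_insert hn, hpn, add_comm, segSum]
  congr 1
  refine Finset.sum_congr rfl fun x hx => ?_
  have hxt : x ≤ t := by
    rcases Finset.mem_insert.1 hx with rfl | hx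
    · rfl
    · exact (hS x hx).le
  simp [prevChange, Finset.filter_insert, not_lt.2 hxt]

/-! ### Explained energy and the gain of a split. -/

/-- The squared block sum divided by the block length: the part of the sum of squares that a
fitted mean explains. -/
noncomputable def blockEnergy (z : ℕ → ℝ) (a b : ℕ) : ℝ :=
  (∑ i ∈ Finset.Ioc a b, z i) ^ 2 / ((b : ℝ) - a)

/-- The part of the sum of squares that the segment means of `S` explain. -/
noncomputable def energy (z : ℕ → ℝ) (n : ℕ) (S : Finset ℕ) : ℝ := segSum (blockEnergy z) n S

theorem segmentCost_eq (y : ℕ → ℝ) {a b : ℕ} (hab : a ≤ b) :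
    segmentCost y a b = ∑ i ∈ Finset.Ioc a b, y i ^ 2 - blockEnergy y a b := by
  rcases hab.eq_or_lt with rfl | hab
  · simp [segmentCost, blockEnergy]
  have h0 : (b : ℝ) - a ≠ 0 := sub_ne_zero.2 (by exact_mod_cast hab.ne')
  have hc : ((Finset.Ioc a b).card : ℝ) = b - a := by
    rw [Nat.card_Ioc, Nat.cast_sub hab.le]
  simp only [segmentCost, blockEnergy, sub_sq, Finset.sum_add_distrib, Finset.sum_sub_distrib,
    ← Finset.sum_mul, ← Finset.mul_sum, Finset.sum_const, nsmul_eq_mul, hc]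
  field_simp
  ring

theorem sum_Ioc_add (f : ℕ → ℝ) {a t b : ℕ} (h1 : a ≤ t) (h2 : t ≤ b) :
    ∑ i ∈ Finset.Ioc a t, f i + ∑ i ∈ Finset.Ioc t b, f i = ∑ i ∈ Finset.Ioc a b, f i :=
  Finset.sum_Ioc_consecutive f h1 h2

/-- Cauchy–Schwarz in the form `(A + B) ^ 2 / (p + q) ≤ A ^ 2 / p + B ^ 2 / q`. An empty block has
energy `0 / 0 = 0`. -/
theorem blockEnergy_add_le (z : ℕ → ℝ) {a t b : ℕ} (h1 : a ≤ t) (h2 : t ≤ b) :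
    blockEnergy z a b ≤ blockEnergy z a t + blockEnergy z t b := by
  rcases h1.eq_or_lt with rfl | h1
  · simp [blockEnergy]
  rcases h2.eq_or_lt with rfl | h2
  · simp [blockEnergy]
  have p : (0 : ℝ) < t - a := sub_pos.2 (by exact_mod_cast h1)
  have q : (0 : ℝ) < b - t := sub_pos.2 (by exact_mod_cast h2)
  simp only [blockEnergy, ← sum_Ioc_add z h1.le h2.le]
  set A := ∑ i ∈ Finset.Ioc a t, z i
  set B := ∑ i ∈ Finset.Ioc t b, z i
  have e : (b : ℝ) - a = (t - a) + (b - t) := by ring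
  rw [e, div_add_div _ _ p.ne' q.ne', div_le_div_iff₀ (by positivity) (by positivity)]
  nlinarith [sq_nonneg (A * ((b : ℝ) - t) - B * ((t : ℝ) - a))]

theorem segmentCost_add_le (y : ℕ → ℝ) (a t b : ℕ) (h1 : a ≤ t) (h2 : t ≤ b) :
    segmentCost y a t + segmentCost y t b ≤ segmentCost y a b := by
  rw [segmentCost_eq y h1, segmentCost_eq y h2, segmentCost_eq y (h1.trans h2),
    ← sum_Ioc_add _ h1 h2]
  linarith [blockEnergy_add_le y h1 h2]

theorem segSum_segmentCost (y : ℕ → ℝ) {n : ℕ} {S : Finset ℕ} (hS : ∀ s ∈ S, 0 < s ∧ s < n) :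
    segSum (segmentCost y) n S = ∑ i ∈ Finset.Ioc 0 n, y i ^ 2 - energy y n S := by
  rw [← segSum_of_additive (h := fun a b => ∑ i ∈ Finset.Ioc a b, y i ^ 2)
    (fun a t b h1 h2 => sum_Ioc_add _ h1 h2) hS, energy, segSum, segSum, segSum,
    ← Finset.sum_sub_distrib]
  exact Finset.sum_congr rfl fun t _ => segmentCost_eq y (prevChange_le S t)

theorem blockEnergy_nonneg (z : ℕ → ℝ) {a b : ℕ} (h : a ≤ b) : 0 ≤ blockEnergy z a b :=
  div_nonneg (sq_nonneg _) (sub_nonneg.2 (by exact_mod_cast h))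

theorem energy_nonneg (z : ℕ → ℝ) (n : ℕ) (S : Finset ℕ) : 0 ≤ energy z n S :=
  Finset.sum_nonneg fun t _ => blockEnergy_nonneg z (prevChange_le S t)

theorem blockEnergy_add_le_energy (z : ℕ → ℝ) {n : ℕ} {S : Finset ℕ} {a t b : ℕ}
    (hb : b ∈ S) (ht : t ∈ S) (hat : a < t) (htb : t < b)
    (hpt : prevChange S t = a) (hpb : prevChange S b = t) :
    blockEnergy z a t + blockEnergy z t b ≤ energy z n S := by
  have : ∑ x ∈ {t, b}, blockEnergy z (prevChange S x) x ≤ energy z n S := by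
    refine Finset.sum_le_sum_of_subset_of_nonneg ?_ fun x _ _ =>
      blockEnergy_nonneg z (prevChange_le S x)
    intro x hx
    simp only [Finset.mem_insert, Finset.mem_singleton] at hx
    rcases hx with rfl | rfl <;> simp [*]
  rwa [Finset.sum_pair htb.ne, hpt, hpb] at this

/-- The gain of splitting a segment in the middle. -/
theorem segmentCost_split_mid (y : ℕ → ℝ) {t r : ℕ} (hr : 0 < r) (hrt : r ≤ t) :
    segmentCost y (t - r) (t + r) = segmentCost y (t - r) t + segmentCost y t (t + r) +
      (∑ i ∈ Finset.Ioc (t - r) t, y i - ∑ i ∈ Finset.Ioc t (t + r), y i) ^ 2 / (2 * r) := by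
  rw [segmentCost_eq y (by omega), segmentCost_eq y (by omega), segmentCost_eq y (by omega),
    ← sum_Ioc_add (a := t - r) (t := t) (b := t + r) _ (by omega) (by omega)]
  simp only [blockEnergy]
  rw [← sum_Ioc_add (a := t - r) (t := t) (b := t + r) y (by omega) (by omega)]
  have hr' : (r : ℝ) ≠ 0 := by exact_mod_cast hr.ne'
  have e1 : ((t + r : ℕ) : ℝ) - (t - r : ℕ) = 2 * r := by
    rw [Nat.cast_sub hrt]; push_cast; ring
  have e2 : (t : ℝ) - (t - r : ℕ) = r := by rw [Nat.cast_sub hrt]; ring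
  have e3 : ((t + r : ℕ) : ℝ) - t = r := by push_cast; ring
  rw [e1, e2, e3]
  field_simp
  ring

theorem segSum_segmentCost_insert_mid (y : ℕ → ℝ) {n : ℕ} {S : Finset ℕ}
    (hS : ∀ s ∈ S, 0 < s ∧ s < n) {t r : ℕ} (hr : 0 < r) (hrt : r < t)
    (h1 : t - r ∈ S) (h2 : t + r ∈ S) (hno : ∀ s ∈ S, s ≤ t - r ∨ t + r ≤ s) :
    segSum (segmentCost y) n S = segSum (segmentCost y) n (insert t S) +
      (∑ i ∈ Finset.Ioc (t - r) t, y i - ∑ i ∈ Finset.Ioc t (t + r), y i) ^ 2 / (2 * r) := by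
  have hp : prevChange S t = t - r := prevChange_eq (Or.inr h1) (by omega) fun s hs hst => by
    have := hno s hs; omega
  have h := segSum_insert_of_next (segmentCost y) (fun s hs => (hS s hs).2) (t := t) (b := t + r)
    (fun ht => by have := hno t ht; omega) (by omega) (Finset.mem_insert_of_mem h2) (by omega)
    (fun x hx htx => by
      rcases Finset.mem_insert.1 hx with rfl | hx
      · exact (hS _ h2).2.le
      · have := hno x hx; omega)
  rw [hp, segmentCost_split_mid y hr hrt.le] at h
  linarith

theorem segSum_congr {h h' : ℕ → ℕ → ℝ} {n : ℕ} {S : Finset ℕ}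
    (hh : ∀ t ∈ insert n S, h (prevChange S t) t = h' (prevChange S t) t) :
    segSum h n S = segSum h' n S := Finset.sum_congr rfl hh

theorem segmentCost_add_const (z : ℕ → ℝ) (c : ℝ) {a b : ℕ} {y : ℕ → ℝ}
    (hy : ∀ i ∈ Finset.Ioc a b, y i = z i + c) : segmentCost y a b = segmentCost z a b := by
  rcases le_or_gt b a with hab | hab
  · simp [segmentCost, Finset.Ioc_eq_empty_of_le hab]
  have h0 : (b : ℝ) - a ≠ 0 := sub_ne_zero.2 (by exact_mod_cast hab.ne')
  have hc : ((Finset.Ioc a b).card : ℝ) = b - a := by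
    rw [Nat.card_Ioc, Nat.cast_sub hab.le]
  refine Finset.sum_congr rfl fun i hi => ?_
  rw [Finset.sum_congr rfl hy, Finset.sum_add_distrib, Finset.sum_const, nsmul_eq_mul, hc, hy i hi]
  field_simp
  ring

end Segmentation

/-! ### Spacing, good noise and the gain at a true changepoint. -/

section Deterministic

variable {m : ℕ} {θ : Fin m → ℝ} {n : ℕ}

/-- The set of true changepoints. -/
noncomputable def trueChanges (θ : Fin m → ℝ) (n : ℕ) : Finset ℕ :=
  Finset.univ.image (changeLoc θ n)

theorem mem_trueChanges {s : ℕ} : s ∈ trueChanges θ n ↔ ∃ j, changeLoc θ n j = s := by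
  simp [trueChanges]

/-- The true changepoints are at distance more than `d` from both ends of the data and at
distance more than `2 d` from each other. -/
structure WellSpaced (θ : Fin m → ℝ) (n d : ℕ) : Prop where
  left : ∀ j, d < changeLoc θ n j
  right : ∀ j, changeLoc θ n j + d < n
  gap : ∀ j k, j < k → changeLoc θ n j + 2 * d < changeLoc θ n k

/-- The noise explains less than the penalty of the `r` points of `R`, for all sets consisting
of the true changepoints, one more point close to each of them, and `R`. -/
def GoodNoise (θ : Fin m → ℝ) (n w : ℕ) (β : ℝ) (z : ℕ → ℝ) : Prop :=
  ∀ W : Fin m → ℕ, (∀ j, changeLoc θ n j ≤ W j + w ∧ W j ≤ changeLoc θ n j + w) →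
    ∀ R : Finset ℕ, R.Nonempty →
      (∀ s ∈ trueChanges θ n ∪ Finset.univ.image W ∪ R, 0 < s ∧ s < n) →
      energy z n (trueChanges θ n ∪ Finset.univ.image W ∪ R) < R.card * β

theorem WellSpaced.mono {d e : ℕ} (h : WellSpaced θ n d) (hed : e ≤ d) : WellSpaced θ n e where
  left j := hed.trans_lt (h.left j)
  right j := lt_of_le_of_lt (by omega) (h.right j)
  gap j k hjk := lt_of_le_of_lt (by omega) (h.gap j k hjk)

theorem WellSpaced.bounds {d : ℕ} (h : WellSpaced θ n d) :
    ∀ s ∈ trueChanges θ n, 0 < s ∧ s < n := by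
  intro s hs
  obtain ⟨j, rfl⟩ := mem_trueChanges.1 hs
  have := h.left j
  have := h.right j
  omega

theorem WellSpaced.far {d : ℕ} (h : WellSpaced θ n d) {j k : Fin m} (hjk : j ≠ k) :
    changeLoc θ n k + 2 * d < changeLoc θ n j ∨ changeLoc θ n j + 2 * d < changeLoc θ n k := by
  rcases lt_or_gt_of_ne hjk with hjk | hjk
  · exact Or.inr (h.gap _ _ hjk)
  · exact Or.inl (h.gap _ _ hjk)

/-- No true changepoint lies strictly inside a segment of `T`, so the mean is constant there and the
segment cost ignores it. -/
theorem trueChanges_subset_cost {μ : Fin (m + 1) → ℝ} (z : ℕ → ℝ) {T : Finset ℕ}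
    (hT : trueChanges θ n ⊆ T) :
    segSum (segmentCost (changeInMean θ μ n z)) n T = segSum (segmentCost z) n T := by
  refine segSum_congr fun t _ => segmentCost_add_const z (μ (segmentIndex θ n t)) fun i hi => ?_
  rw [Finset.mem_Ioc] at hi
  have : segmentIndex θ n i = segmentIndex θ n t := by
    rw [segmentIndex, segmentIndex, Fin.mk.injEq]
    congr 1
    ext j
    simp only [Finset.mem_filter, Finset.mem_univ, true_and]
    refine ⟨fun h => h.trans_le hi.2, fun h => lt_of_le_of_lt ?_ hi.1⟩
    exact le_prevChange (hT (mem_trueChanges.2 ⟨j, rfl⟩)) h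
  simp [changeInMean, this]

theorem segmentIndex_left {d : ℕ} (h : WellSpaced θ n d) (j : Fin m) {i : ℕ}
    (hi : i ∈ Finset.Ioc (changeLoc θ n j - d) (changeLoc θ n j)) :
    segmentIndex θ n i = j.castSucc := by
  rw [Finset.mem_Ioc] at hi
  have : Finset.univ.filter (fun k => changeLoc θ n k < i) = Finset.Iio j := by
    ext k
    simp only [Finset.mem_filter, Finset.mem_univ, true_and, Finset.mem_Iio]
    constructor
    · intro hk
      by_contra hkj
      rcases (not_lt.1 hkj).eq_or_lt with rfl | hkj
      · omega
      · have := h.gap _ _ hkj; omega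
    · intro hk
      have := h.gap _ _ hk; omega
  ext
  simp [segmentIndex, this]

theorem segmentIndex_right {d : ℕ} (h : WellSpaced θ n d) (j : Fin m) {i : ℕ}
    (hi : i ∈ Finset.Ioc (changeLoc θ n j) (changeLoc θ n j + d)) :
    segmentIndex θ n i = j.succ := by
  rw [Finset.mem_Ioc] at hi
  have : Finset.univ.filter (fun k => changeLoc θ n k < i) = Finset.Iic j := by
    ext k
    simp only [Finset.mem_filter, Finset.mem_univ, true_and, Finset.mem_Iic]
    constructor
    · intro hk
      by_contra hkj
      have := h.gap _ _ (not_le.1 hkj); omega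
    · intro hk
      rcases hk.eq_or_lt with rfl | hk
      · omega
      · have := h.gap _ _ hk; omega
  ext
  simp [segmentIndex, this]

/-- The window sums differ by `r * D` from the jump `D`, plus noise `A - B`. Good noise bounds the
energy of the two windows by `2 * β`, so the noise can reduce the signal gain only by a controlled
amount. -/
theorem gain_lower_bound {μ : Fin (m + 1) → ℝ} {z : ℕ → ℝ} {d w r : ℕ} {β δ : ℝ}
    (h : WellSpaced θ n d) (hr : 0 < r) (hrd : r ≤ d) (hz : GoodNoise θ n w β z) (hδ : 0 ≤ δ)
    (hμ : ∀ k : Fin m, δ ≤ |μ k.castSucc - μ k.succ|) (j : Fin m) :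
    r * δ ^ 2 / 4 - 2 * β ≤
      (∑ i ∈ Finset.Ioc (changeLoc θ n j - r) (changeLoc θ n j), changeInMean θ μ n z i -
        ∑ i ∈ Finset.Ioc (changeLoc θ n j) (changeLoc θ n j + r), changeInMean θ μ n z i) ^ 2
          / (2 * r) := by
  have h' := h.mono hrd
  set t := changeLoc θ n j with ht
  have hl := h'.left j
  have hrt := h'.right j
  rw [← ht] at hl hrt
  have hA : ∑ i ∈ Finset.Ioc (t - r) t, changeInMean θ μ n z i =
      ∑ i ∈ Finset.Ioc (t - r) t, z i + r * μ j.castSucc := by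
    rw [Finset.sum_congr rfl fun i hi => by
      rw [changeInMean, segmentIndex_left h' j hi], Finset.sum_add_distrib, Finset.sum_const,
      nsmul_eq_mul, Nat.card_Ioc]
    congr 3
    omega
  have hB : ∑ i ∈ Finset.Ioc t (t + r), changeInMean θ μ n z i =
      ∑ i ∈ Finset.Ioc t (t + r), z i + r * μ j.succ := by
    rw [Finset.sum_congr rfl fun i hi => by
      rw [changeInMean, segmentIndex_right h' j hi], Finset.sum_add_distrib, Finset.sum_const,
      nsmul_eq_mul, Nat.card_Ioc]
    congr 3
    omega
  have hmem : ∀ s ∈ trueChanges θ n ∪ Finset.univ.image (changeLoc θ n) ∪ {t - r, t + r},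
      (s = t ∨ s ≤ t - r ∨ t + r ≤ s) ∧ 0 < s ∧ s < n := by
    intro s hs
    simp only [trueChanges, Finset.union_self, Finset.mem_union, Finset.mem_image, Finset.mem_univ,
      true_and, Finset.mem_insert, Finset.mem_singleton] at hs
    rcases hs with ⟨k, rfl⟩ | rfl | rfl
    · have hk := h'.bounds _ (mem_trueChanges.2 ⟨k, rfl⟩)
      refine ⟨?_, hk⟩
      by_cases hkj : k = j
      · subst hkj; exact Or.inl rfl
      · have := h'.far hkj
        rw [← ht] at this
        omega
    · omega
    · omega
  -- The companions are the true changepoints themselves, so only the two window ends are charged.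
  have hE := hz (changeLoc θ n) (fun j => by omega) {t - r, t + r} (by simp)
    (fun s hs => (hmem s hs).2)
  have hE2 := blockEnergy_add_le_energy z (n := n)
    (S := trueChanges θ n ∪ Finset.univ.image (changeLoc θ n) ∪ {t - r, t + r})
    (a := t - r) (t := t) (b := t + r) (by simp) (by simp [t]) (by omega) (by omega)
    (prevChange_eq (by simp) (by omega) fun s hs hst => by
      have := (hmem s hs).1; omega)
    (prevChange_eq (by simp [t]) (by omega) fun s hs hst => by
      have := (hmem s hs).1; omega)
  rw [Finset.card_pair (by omega)] at hE
  have hr' : (0 : ℝ) < r := by exact_mod_cast hr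
  have e2 : (t : ℝ) - (t - r : ℕ) = r := by rw [Nat.cast_sub hl.le]; ring
  have e3 : ((t + r : ℕ) : ℝ) - t = r := by push_cast; ring
  simp only [blockEnergy, e2, e3] at hE2
  rw [hA, hB]
  set A := ∑ i ∈ Finset.Ioc (t - r) t, z i
  set B := ∑ i ∈ Finset.Ioc t (t + r), z i
  have hsq : δ ^ 2 ≤ (μ j.castSucc - μ j.succ) ^ 2 := by
    rw [← sq_abs (μ _ - _)]
    exact pow_le_pow_left₀ hδ (hμ j) 2
  have hAB : A ^ 2 + B ^ 2 < 2 * β * r := by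
    rw [← add_div] at hE2
    have := hE2.trans_lt hE
    rwa [div_lt_iff₀ hr'] at this
  rw [le_div_iff₀ (by positivity)]
  set D := μ j.castSucc - μ j.succ with hD
  have e : A + r * μ j.castSucc - (B + r * μ j.succ) = r * D + (A - B) := by rw [hD]; ring
  rw [e]
  -- Here `(r * D + e) ^ 2 ≥ (r * D) ^ 2 / 2 - e ^ 2` with `e = A - B`, and `e ^ 2 ≤ 2 * (A ^ 2 + B
  -- ^ 2) < 4 * β * r`.
  nlinarith [sq_nonneg (r * D + 2 * (A - B)), sq_nonneg (A + B), mul_pos hr' hr',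
    mul_le_mul_of_nonneg_left hsq (mul_pos hr' hr').le]

/-! ### The individual cores. -/

theorem mem_dealt {L k t : ℕ} : t ∈ dealt n L k ↔ (1 ≤ t ∧ t ≤ n - 1) ∧ t % L = k % L := by
  simp [dealt]

/-- The points `t - L`, `t`, `t + L` share a residue class with no candidate strictly between them.
Adding all three costs at most `3 * β` and gains at least `L * δ ^ 2 / 4 - 2 * β`, whence the `5 *
β` in `hbig`. -/
theorem mem_of_isPelt_dealt {μ : Fin (m + 1) → ℝ} {z : ℕ → ℝ} {w L k : ℕ} {β δ : ℝ}
    {S : Finset ℕ} (hβ : 0 < β) (h : WellSpaced θ n L) (hL : 0 < L) (hz : GoodNoise θ n w β z)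
    (hδ : 0 ≤ δ) (hμ : ∀ k : Fin m, δ ≤ |μ k.castSucc - μ k.succ|) (hbig : 5 * β < L * δ ^ 2 / 4)
    (j : Fin m) (hk : changeLoc θ n j % L = k % L)
    (hS : IsPelt (changeInMean θ μ n z) n β (dealt n L k) S) : changeLoc θ n j ∈ S := by
  by_contra hj
  have hg := gain_lower_bound h hL le_rfl hz hδ hμ j
  set t := changeLoc θ n j with ht
  set y := changeInMean θ μ n z
  have hl := h.left j
  have hr := h.right j
  rw [← ht] at hl hr
  have hSb : ∀ s ∈ S, 0 < s ∧ s < n := fun s hs => by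
    have := (mem_dealt.1 (hS.1 hs)).1; omega
  have hmodl : (t - L) % L = k % L := by
    rw [← hk, ← Nat.mod_eq_sub_mod hl.le]
  have hsub : insert t (S ∪ {t - L, t + L}) ⊆ dealt n L k := by
    intro s hs
    simp only [Finset.mem_insert, Finset.mem_union, Finset.mem_singleton] at hs
    rcases hs with rfl | hs | rfl | rfl
    · exact mem_dealt.2 ⟨by omega, hk⟩
    · exact hS.1 hs
    · exact mem_dealt.2 ⟨by omega, hmodl⟩
    · exact mem_dealt.2 ⟨by omega, by simpa using hk⟩
  have hTb : ∀ s ∈ insert t (S ∪ {t - L, t + L}), 0 < s ∧ s < n := fun s hs => by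
    have := (mem_dealt.1 (hsub hs)).1; omega
  have hTb' : ∀ s ∈ S ∪ {t - L, t + L}, 0 < s ∧ s < n :=
    fun s hs => hTb s (Finset.mem_insert_of_mem hs)
  have hno : ∀ s ∈ S ∪ {t - L, t + L}, s ≤ t - L ∨ t + L ≤ s := by
    intro s hs
    simp only [Finset.mem_insert, Finset.mem_union, Finset.mem_singleton] at hs
    rcases hs with hs | rfl | rfl
    · have hsk := (mem_dealt.1 (hS.1 hs)).2
      have hst : s ≠ t := fun e => hj (e ▸ hs)
      have hmod : s ≡ t [MOD L] := hsk.trans hk.symm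
      rcases lt_or_gt_of_ne hst with hlt | hlt
      · have h1 := (Nat.modEq_iff_dvd' hlt.le).1 hmod
        have := Nat.le_of_dvd (by omega) h1
        omega
      · have h1 := (Nat.modEq_iff_dvd' hlt.le).1 hmod.symm
        have := Nat.le_of_dvd (by omega) h1
        omega
    · exact Or.inl le_rfl
    · exact Or.inr le_rfl
  have hmin := hS.2 _ hsub
  rw [penalisedCost_eq y β fun s hs => (hSb s hs).2,
    penalisedCost_eq y β fun s hs => (hTb s hs).2] at hmin
  have h1 := segSum_union_le (segmentCost_add_le y) hSb {t - L, t + L}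
    fun s hs => hTb' s (Finset.mem_union_right _ hs)
  rw [segSum_segmentCost_insert_mid y hTb' hL hl (by simp) (by simp) hno] at h1
  have hcard : (insert t (S ∪ {t - L, t + L})).card ≤ S.card + 3 :=
    (Finset.card_insert_le _ _).trans
      (Nat.succ_le_succ ((Finset.card_union_le _ _).trans (Nat.add_le_add_left Finset.card_le_two _)))
  have hcard' : ((insert t (S ∪ {t - L, t + L})).card : ℝ) ≤ S.card + 3 := by exact_mod_cast hcard
  nlinarith [mul_le_mul_of_nonneg_right hcard' hβ.le]

/-! ### The final run and the Deal procedure. -/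

theorem card_trueChanges_le : (trueChanges θ n).card ≤ m :=
  Finset.card_image_le.trans_eq (by simp)

/-- The cost of a minimiser is at most the energy of the noise plus the penalty for the true
changepoints. -/
theorem cost_le_of_isPelt {μ : Fin (m + 1) → ℝ} {z : ℕ → ℝ} {d : ℕ} {β : ℝ} {B S : Finset ℕ}
    (hβ : 0 < β) (h : WellSpaced θ n d) (hB : trueChanges θ n ⊆ B) (hSb : ∀ s ∈ S, s < n)
    (hS : IsPelt (changeInMean θ μ n z) n β B S) :
    segSum (segmentCost (changeInMean θ μ n z)) n S + S.card * β ≤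
      ∑ i ∈ Finset.Ioc 0 n, z i ^ 2 + m * β := by
  have hmin := hS.2 _ hB
  rw [penalisedCost_eq _ β hSb, penalisedCost_eq _ β fun s hs => (h.bounds s hs).2,
    trueChanges_subset_cost z subset_rfl, segSum_segmentCost z h.bounds] at hmin
  have h1 := energy_nonneg z n (trueChanges θ n)
  have h2 : ((trueChanges θ n).card : ℝ) ≤ m := by exact_mod_cast card_trueChanges_le
  nlinarith [mul_le_mul_of_nonneg_right h2 hβ.le]

/-- If no estimate is near `t`, refine `S` by `t - w`, `t + w` and the true changepoints, inserting
`t` last. This last insertion has the full gain, while the noise explains less than `(S.card + 2) *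
β`; the upper bound on the minimal cost is then violated. -/
theorem exists_close_of_isPelt {μ : Fin (m + 1) → ℝ} {z : ℕ → ℝ} {w : ℕ} {β δ : ℝ}
    {B S : Finset ℕ} (hβ : 0 < β) (h : WellSpaced θ n w) (hw : 0 < w) (hz : GoodNoise θ n w β z)
    (hδ : 0 ≤ δ) (hμ : ∀ k : Fin m, δ ≤ |μ k.castSucc - μ k.succ|)
    (hbig : (m + 5) * β < w * δ ^ 2 / 4)
    (hB : trueChanges θ n ⊆ B) (hBb : ∀ s ∈ B, 0 < s ∧ s < n)
    (hS : IsPelt (changeInMean θ μ n z) n β B S) (j : Fin m) :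
    ∃ s ∈ S, changeLoc θ n j ≤ s + w ∧ s ≤ changeLoc θ n j + w := by
  by_contra! hcon
  have hSb := fun s hs => hBb s (hS.1 hs)
  have hcost := cost_le_of_isPelt hβ h hB (fun s hs => (hSb s hs).2) hS
  have hg := gain_lower_bound h hw le_rfl hz hδ hμ j
  set t := changeLoc θ n j with ht
  set y := changeInMean θ μ n z
  have hl := h.left j
  have hr := h.right j
  rw [← ht] at hl hr
  set R : Finset ℕ := S ∪ {t - w, t + w} with hR
  set V := (trueChanges θ n).erase t ∪ R with hV
  have hV' : insert t V = trueChanges θ n ∪ Finset.univ.image (changeLoc θ n) ∪ R := by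
    rw [hV, ← Finset.insert_union, Finset.insert_erase (mem_trueChanges.2 ⟨j, rfl⟩)]
    simp [trueChanges]
  have hRb : ∀ s ∈ R, 0 < s ∧ s < n := by
    intro s hs
    simp only [hR, Finset.mem_union, Finset.mem_insert, Finset.mem_singleton] at hs
    rcases hs with hs | rfl | rfl
    · exact hSb s hs
    · omega
    · omega
  have hVb : ∀ s ∈ V, 0 < s ∧ s < n := by
    intro s hs
    rcases Finset.mem_union.1 hs with hs | hs
    · exact h.bounds s (Finset.mem_of_mem_erase hs)
    · exact hRb s hs
  have hno : ∀ s ∈ V, s ≤ t - w ∨ t + w ≤ s := by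
    intro s hs
    rw [hV, hR] at hs
    simp only [Finset.mem_union, Finset.mem_insert, Finset.mem_singleton, Finset.mem_erase] at hs
    rcases hs with ⟨hst, hs⟩ | hs | rfl | rfl
    · obtain ⟨k, rfl⟩ := mem_trueChanges.1 hs
      have hkj : k ≠ j := fun e => hst (e ▸ ht.symm)
      have := h.far hkj
      rw [← ht] at this
      omega
    · have := hcon s hs
      omega
    · exact Or.inl le_rfl
    · exact Or.inr le_rfl
  have hVt : ∀ s ∈ insert t V, 0 < s ∧ s < n := by
    intro s hs
    rcases Finset.mem_insert.1 hs with rfl | hs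
    · omega
    · exact hVb s hs
  have h1 := segSum_mono_of_subset (segmentCost_add_le y) (S := S) (T := V)
    (by intro s hs; simp [hV, hR, hs]) hVb
  rw [segSum_segmentCost_insert_mid y hVb hw hl (by simp [hV, hR]) (by simp [hV, hR]) hno,
    hV', trueChanges_subset_cost z (by intro s hs; simp [hs]),
    segSum_segmentCost z (by rw [← hV']; exact hVt)] at h1
  have h2 := hz (changeLoc θ n) (fun j => by omega) R (by simp [hR]) (by rw [← hV']; exact hVt)
  have hcard : (R.card : ℝ) ≤ S.card + 2 := by
    exact_mod_cast (Finset.card_union_le _ _).trans (Nat.add_le_add_left Finset.card_le_two _)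
  nlinarith [mul_le_mul_of_nonneg_right hcard hβ.le]

theorem accurate_of_isPelt {μ : Fin (m + 1) → ℝ} {z : ℕ → ℝ} {α β δ : ℝ}
    {B S : Finset ℕ} (hβ : 0 < β) (h : WellSpaced θ n ⌈Real.log n ^ (1 + α)⌉₊)
    (hw : 0 < ⌈Real.log n ^ (1 + α)⌉₊) (hz : GoodNoise θ n ⌈Real.log n ^ (1 + α)⌉₊ β z)
    (hδ : 0 ≤ δ) (hμ : ∀ k : Fin m, δ ≤ |μ k.castSucc - μ k.succ|)
    (hbig : (m + 5) * β < (⌈Real.log n ^ (1 + α)⌉₊ : ℝ) * δ ^ 2 / 4)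
    (hB : trueChanges θ n ⊆ B) (hBb : ∀ s ∈ B, 0 < s ∧ s < n)
    (hS : IsPelt (changeInMean θ μ n z) n β B S) : Accurate θ α n S := by
  choose W hWS hW using exists_close_of_isPelt hβ h hw hz hδ hμ hbig hB hBb hS
  set w := ⌈Real.log n ^ (1 + α)⌉₊
  have hSb := fun s hs => hBb s (hS.1 hs)
  -- The gaps exceed `2 * w`, so points within `w` of distinct true changepoints keep their order.
  have hmono : StrictMono W := fun j k hjk => by
    have := h.gap j k hjk
    have := hW j
    have := hW k
    omega
  have himg : Finset.univ.image W ⊆ S := by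
    intro s hs
    obtain ⟨j, _, rfl⟩ := Finset.mem_image.1 hs
    exact hWS j
  have hcimg : (Finset.univ.image W).card = m := by
    rw [Finset.card_image_of_injective _ hmono.injective]
    simp
  have hcard : S.card = m := by
    by_contra hne
    have hcost := cost_le_of_isPelt hβ h hB (fun s hs => (hSb s hs).2) hS
    -- The surplus estimates: the noise explains less than `R.card * β`, exactly the penalty that
    -- dropping them would save.
    set R := S \ Finset.univ.image W
    have hRc : R.card + m = S.card := by
      rw [← hcimg]
      exact Finset.card_sdiff_add_card_eq_card himg
    have hT : trueChanges θ n ∪ Finset.univ.image W ∪ R = trueChanges θ n ∪ S := by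
      rw [Finset.union_assoc, Finset.union_sdiff_of_subset himg]
    have hTb : ∀ s ∈ trueChanges θ n ∪ S, 0 < s ∧ s < n := by
      intro s hs
      rcases Finset.mem_union.1 hs with hs | hs
      · exact h.bounds s hs
      · exact hSb s hs
    have h2 := hz W hW R (Finset.card_pos.1 (by omega)) (by rw [hT]; exact hTb)
    have h1 := segSum_mono_of_subset (segmentCost_add_le (changeInMean θ μ n z))
      (Finset.subset_union_right (s₁ := trueChanges θ n) (s₂ := S)) hTb
    rw [trueChanges_subset_cost z Finset.subset_union_left, segSum_segmentCost z hTb] at h1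
    rw [hT] at h2
    have h3 : (R.card : ℝ) + m = S.card := by exact_mod_cast hRc
    rw [← h3] at hcost
    linarith
  refine ⟨hcard, fun j => ?_⟩
  have := congrFun (Finset.orderEmbOfFin_unique hcard hWS hmono) j
  rw [← this, abs_le]
  have := hW j
  constructor <;> omega

theorem accurate_of_isDealOutput {μ : Fin (m + 1) → ℝ} {z : ℕ → ℝ} {L : ℕ} {α β δ : ℝ}
    {S : Finset ℕ} (hβ : 0 < β) (h : WellSpaced θ n L)
    (hw : 0 < ⌈Real.log n ^ (1 + α)⌉₊) (hwL : ⌈Real.log n ^ (1 + α)⌉₊ ≤ L)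
    (hz : GoodNoise θ n ⌈Real.log n ^ (1 + α)⌉₊ β z)
    (hδ : 0 ≤ δ) (hμ : ∀ k : Fin m, δ ≤ |μ k.castSucc - μ k.succ|)
    (hbig : (m + 5) * β < (⌈Real.log n ^ (1 + α)⌉₊ : ℝ) * δ ^ 2 / 4)
    (hS : IsDealOutput (changeInMean θ μ n z) n L β S) : Accurate θ α n S := by
  obtain ⟨C, hC, hS⟩ := hS
  refine accurate_of_isPelt hβ (h.mono hwL) hw hz hδ hμ hbig ?_ ?_ hS
  · intro s hs
    obtain ⟨j, rfl⟩ := mem_trueChanges.1 hs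
    have hL : 0 < L := hw.trans_le hwL
    have hbig' : 5 * β < L * δ ^ 2 / 4 := by
      have h1 : (⌈Real.log n ^ (1 + α)⌉₊ : ℝ) ≤ L := by exact_mod_cast hwL
      have h2 : (0 : ℝ) ≤ m * β := by positivity
      nlinarith [mul_le_mul_of_nonneg_right h1 (sq_nonneg δ)]
    -- Cores are numbered from `1`, so residue `0` belongs to core `L`.
    obtain ⟨k, hk, hkm⟩ : ∃ k ∈ Finset.Icc 1 L, changeLoc θ n j % L = k % L := by
      by_cases h0 : changeLoc θ n j % L = 0
      · exact ⟨L, Finset.mem_Icc.2 ⟨hL, le_rfl⟩, by simp [h0]⟩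
      · exact ⟨changeLoc θ n j % L,
          Finset.mem_Icc.2 ⟨Nat.pos_of_ne_zero h0, (Nat.mod_lt _ hL).le⟩, by simp⟩
    exact Finset.mem_biUnion.2
      ⟨k, hk, mem_of_isPelt_dealt hβ h hL hz hδ hμ hbig' j hkm (hC k hk)⟩
  · intro s hs
    obtain ⟨k, hk, hs⟩ := Finset.mem_biUnion.1 hs
    have := (mem_dealt.1 ((hC k hk).1 hs)).1
    omega

end Deterministic

/-! ### Independence and exponential moments of the noise energy. -/

section Noise

open scoped ENNReal

/-- The exponential moment of order `r` of a chi-squared variable with one degree of freedom. -/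
noncomputable def chiSqMoment (r : ℝ) : ℝ≥0∞ :=
  ∫⁻ x, ENNReal.ofReal (Real.exp (r * x ^ 2)) ∂gaussianReal 0 1

theorem chiSqMoment_lt_top {r : ℝ} (hr : r < 1 / 2) : chiSqMoment r < ∞ := by
  rw [chiSqMoment, gaussianReal_of_var_ne_zero 0 one_ne_zero,
    lintegral_withDensity_eq_lintegral_mul _ (measurable_gaussianPDF 0 1) (by fun_prop)]
  have hint : Integrable (fun x : ℝ =>
      (Real.sqrt (2 * Real.pi))⁻¹ * Real.exp (-(1 / 2 - r) * x ^ 2)) :=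
    (integrable_exp_neg_mul_sq (by linarith)).const_mul _
  refine lt_of_le_of_lt (lintegral_mono fun x => ?_) hint.lintegral_lt_top
  simp only [Pi.mul_apply, gaussianPDF, gaussianPDFReal]
  rw [← ENNReal.ofReal_mul (by positivity), mul_assoc, ← Real.exp_add]
  apply le_of_eq
  congr 2
  · simp
  · congr 1
    simp
    ring

theorem one_le_chiSqMoment {r : ℝ} (hr : 0 ≤ r) : 1 ≤ chiSqMoment r := by
  calc (1 : ℝ≥0∞) = ∫⁻ _, 1 ∂gaussianReal 0 1 := by simp
    _ ≤ _ := lintegral_mono fun x => by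
      rw [← ENNReal.ofReal_one]
      exact ENNReal.ofReal_le_ofReal (Real.one_le_exp (by positivity))

variable {Ω : Type*} [MeasurableSpace Ω] {P : Measure Ω} {X : ℕ → Ω → ℝ}

/-- Independence is known only for indices in `I`; a functional that depends on `C ⊆ I` factors
through those coordinates after padding the others with `0`. -/
theorem indepFun_of_dependsOn {I : Finset ℕ} (hX : ∀ i, Measurable (X i))
    (hindep : iIndepFun (fun i : I => X i) P) {A B : Finset ℕ} (hA : A ⊆ I) (hB : B ⊆ I)
    (hAB : Disjoint A B) {F G : (ℕ → ℝ) → ℝ} (hF : Measurable F) (hG : Measurable G)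
    (hFA : DependsOn F (A : Set ℕ)) (hGB : DependsOn G (B : Set ℕ)) :
    IndepFun (fun ω => F fun i => X i ω) (fun ω => G fun i => X i ω) P := by
  classical
  have key : ∀ {C : Finset ℕ} (_ : C ⊆ I) {H : (ℕ → ℝ) → ℝ} (_ : Measurable H)
      (_ : DependsOn H (C : Set ℕ)), ∃ φ : ((C.subtype (· ∈ I)) → ℝ) → ℝ, Measurable φ ∧
        ∀ ω, H (fun i => X i ω) = φ fun i => X i.1 ω := by
    intro C hC H hH hHC
    refine ⟨fun x => H fun i => if h : ∃ hi : i ∈ I, (⟨i, hi⟩ : I) ∈ C.subtype (· ∈ I) then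
      x ⟨⟨i, h.1⟩, h.2⟩ else 0, hH.comp (measurable_pi_lambda _ fun i => ?_), fun ω => ?_⟩
    · split_ifs with h
      · exact measurable_pi_apply _
      · exact measurable_const
    · refine hHC fun i hi => ?_
      have : ∃ hi : i ∈ I, (⟨i, hi⟩ : I) ∈ C.subtype (· ∈ I) :=
        ⟨hC hi, by simpa using hi⟩
      simp only [dif_pos this]
  obtain ⟨φ, hφ, hφe⟩ := key hA hF hFA
  obtain ⟨ψ, hψ, hψe⟩ := key hB hG hGB
  have hdis : Disjoint (A.subtype (· ∈ I)) (B.subtype (· ∈ I)) := by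
    rw [Finset.disjoint_left] at hAB ⊢
    intro i hi hi'
    exact hAB (by simpa using hi) (by simpa using hi')
  have := (hindep.indepFun_finset _ _ hdis fun i => hX i).comp hφ hψ
  simp only [hφe, hψe]
  exact this

theorem dependsOn_sum_Ioc {a b : ℕ} :
    DependsOn (fun z : ℕ → ℝ => ∑ i ∈ Finset.Ioc a b, z i) (Finset.Ioc a b : Set ℕ) :=
  fun _ _ h => Finset.sum_congr rfl fun i hi => h i (by simpa using hi)

theorem measurable_sum_Ioc (a b : ℕ) :
    Measurable (fun z : ℕ → ℝ => ∑ i ∈ Finset.Ioc a b, z i) :=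
  Finset.measurable_sum _ fun i _ => measurable_pi_apply i

theorem hasLaw_sum_Ioc [IsProbabilityMeasure P] {n : ℕ} {v : NNReal}
    (hX : ∀ i, Measurable (X i))
    (hlaw : ∀ i ∈ Finset.Icc 1 n, HasLaw (X i) (gaussianReal 0 v) P)
    (hindep : iIndepFun (fun i : Finset.Icc 1 n => X i) P) {a b : ℕ} (hab : a ≤ b) (hb : b ≤ n) :
    P.map (fun ω => ∑ i ∈ Finset.Ioc a b, X i ω) = gaussianReal 0 ((b - a : ℕ) * v) := by
  induction b, hab using Nat.le_induction with
  | base => simp [Measure.map_const]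
  | succ b hab ih =>
    have h1 : IndepFun (fun ω => ∑ i ∈ Finset.Ioc a b, X i ω)
        (fun ω => ∑ i ∈ Finset.Ioc b (b + 1), X i ω) P :=
      indepFun_of_dependsOn hX hindep (A := Finset.Ioc a b) (B := Finset.Ioc b (b + 1))
        (fun i hi => by rw [Finset.mem_Ioc] at hi; rw [Finset.mem_Icc]; omega)
        (fun i hi => by rw [Finset.mem_Ioc] at hi; rw [Finset.mem_Icc]; omega)
        (by
          rw [Finset.disjoint_left]
          intro i hi hi'
          rw [Finset.mem_Ioc] at hi hi'
          omega)
        (measurable_sum_Ioc _ _) (measurable_sum_Ioc _ _) dependsOn_sum_Ioc dependsOn_sum_Ioc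
    have h2 := gaussianReal_add_gaussianReal_of_indepFun h1 (ih (by omega))
      (by simpa using (hlaw (b + 1) (by rw [Finset.mem_Icc]; omega)).map_eq)
    have e : (fun ω => ∑ i ∈ Finset.Ioc a b, X i ω) + (fun ω => ∑ i ∈ Finset.Ioc b (b + 1), X i ω) =
        fun ω => ∑ i ∈ Finset.Ioc a (b + 1), X i ω := by
      ext ω
      exact sum_Ioc_add (fun i => X i ω) hab (Nat.le_succ b)
    rw [e] at h2
    rw [h2, add_zero, Nat.succ_sub hab]
    congr 1
    push_cast
    ring

theorem measurable_blockEnergy (a b : ℕ) : Measurable (fun z : ℕ → ℝ => blockEnergy z a b) :=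
  ((measurable_sum_Ioc a b).pow_const 2).div_const _

theorem measurable_energy (n : ℕ) (S : Finset ℕ) : Measurable (fun z : ℕ → ℝ => energy z n S) :=
  Finset.measurable_sum _ fun _ _ => measurable_blockEnergy _ _

/-- The block energy over `v` is the square of the standardised block sum, a standard normal
variable. -/
theorem lintegral_exp_blockEnergy [IsProbabilityMeasure P] {n : ℕ} {v : NNReal} (hv : v ≠ 0)
    (hX : ∀ i, Measurable (X i))
    (hlaw : ∀ i ∈ Finset.Icc 1 n, HasLaw (X i) (gaussianReal 0 v) P)
    (hindep : iIndepFun (fun i : Finset.Icc 1 n => X i) P) (r : ℝ) {a b : ℕ} (hab : a < b)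
    (hb : b ≤ n) :
    ∫⁻ ω, ENNReal.ofReal (Real.exp (r / v * blockEnergy (fun i => X i ω) a b)) ∂P =
      chiSqMoment r := by
  have hmeas : Measurable (fun ω => ∑ i ∈ Finset.Ioc a b, X i ω) :=
    Finset.measurable_sum _ fun i _ => hX i
  have hv' : (0 : ℝ) < v := by positivity
  have hl : (0 : ℝ) < b - a := sub_pos.2 (by exact_mod_cast hab)
  have hs : (0 : ℝ) < Real.sqrt ((b - a) * v) := Real.sqrt_pos.2 (by positivity)
  have hlaw' : P.map (fun ω => (∑ i ∈ Finset.Ioc a b, X i ω) / Real.sqrt ((b - a) * v)) =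
      gaussianReal 0 1 := by
    have h1 := gaussianReal_map_div_const (μ := 0) (v := ((b - a : ℕ) * v))
      (Real.sqrt ((b - a) * v))
    rw [← hasLaw_sum_Ioc hX hlaw hindep hab.le hb, Measure.map_map (by fun_prop) hmeas] at h1
    refine h1.trans ?_
    congr 1
    · simp
    · ext
      simp only [NNReal.coe_div, NNReal.coe_mul, NNReal.coe_natCast, NNReal.coe_mk, NNReal.coe_one]
      rw [Real.sq_sqrt (by positivity), Nat.cast_sub hab.le, div_self (by positivity)]
  rw [chiSqMoment, ← hlaw', lintegral_map (by fun_prop) (hmeas.div_const _)]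
  refine lintegral_congr fun ω => ?_
  rw [div_pow, Real.sq_sqrt (by positivity), blockEnergy]
  congr 2
  field_simp

theorem dependsOn_energy {n : ℕ} {S : Finset ℕ} (hS : ∀ s ∈ S, s < n) :
    DependsOn (fun z : ℕ → ℝ => energy z n S) (Finset.Ioc 0 n : Set ℕ) := by
  intro z z' h
  refine segSum_congr fun t ht => ?_
  have htn : t ≤ n := by
    rcases Finset.mem_insert.1 ht with rfl | ht
    · rfl
    · exact (hS t ht).le
  rw [blockEnergy, blockEnergy, Finset.sum_congr rfl fun i hi => h i ?_]
  simp only [Finset.coe_Ioc, Set.mem_Ioc]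
  have := Finset.mem_Ioc.1 hi
  omega

/-- Each of the `S.card + 1` independent blocks contributes one factor. The induction removes the
last changepoint, so the right end `t` has to vary. -/
theorem lintegral_exp_energy [IsProbabilityMeasure P] {n : ℕ} {v : NNReal} (hv : v ≠ 0)
    (hX : ∀ i, Measurable (X i))
    (hlaw : ∀ i ∈ Finset.Icc 1 n, HasLaw (X i) (gaussianReal 0 v) P)
    (hindep : iIndepFun (fun i : Finset.Icc 1 n => X i) P) (r : ℝ) (S : Finset ℕ) :
    ∀ t, 0 < t → t ≤ n → (∀ s ∈ S, 0 < s ∧ s < t) →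
    ∫⁻ ω, ENNReal.ofReal (Real.exp (r / v * energy (fun i => X i ω) t S)) ∂P =
      chiSqMoment r ^ (S.card + 1) := by
  have hXp : Measurable fun ω i => X i ω := measurable_pi_lambda _ hX
  induction S using Finset.induction_on_max with
  | empty =>
    intro t ht htn _
    simp only [energy, segSum_empty]
    rw [lintegral_exp_blockEnergy hv hX hlaw hindep r ht htn]
    simp
  | insert s S hs ih =>
    intro t ht htn hS
    have hst := hS s (Finset.mem_insert_self _ _)
    have hsS : s ∉ S := fun h => (hs s h).false
    have hE : ∀ ω, ENNReal.ofReal (Real.exp (r / v * energy (fun i => X i ω) t (insert s S))) =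
        ENNReal.ofReal (Real.exp (r / v * energy (fun i => X i ω) s S)) *
          ENNReal.ofReal (Real.exp (r / v * blockEnergy (fun i => X i ω) s t)) := by
      intro ω
      rw [← ENNReal.ofReal_mul (Real.exp_pos _).le, ← Real.exp_add, ← mul_add, energy,
        segSum_insert_last _ hs hst.2, energy]
    have hind : IndepFun (fun ω => energy (fun i => X i ω) s S)
        (fun ω => blockEnergy (fun i => X i ω) s t) P :=
      indepFun_of_dependsOn hX hindep (A := Finset.Ioc 0 s) (B := Finset.Ioc s t)
        (F := fun z => energy z s S) (G := fun z => blockEnergy z s t)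
        (fun i hi => by rw [Finset.mem_Ioc] at hi; rw [Finset.mem_Icc]; omega)
        (fun i hi => by rw [Finset.mem_Ioc] at hi; rw [Finset.mem_Icc]; omega)
        (by
          rw [Finset.disjoint_left]
          intro i hi hi'
          rw [Finset.mem_Ioc] at hi hi'
          omega)
        (measurable_energy _ _) (measurable_blockEnergy _ _) (dependsOn_energy hs)
        (fun z z' h => by
          have := dependsOn_sum_Ioc h
          simp only [blockEnergy] at this ⊢
          rw [this])
    have hg : Measurable fun x : ℝ => ENNReal.ofReal (Real.exp (r / v * x)) := by fun_prop
    simp only [hE]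
    rw [lintegral_mul_eq_lintegral_mul_lintegral_of_indepFun''
      (f := fun ω => ENNReal.ofReal (Real.exp (r / v * energy (fun i => X i ω) s S)))
      (g := fun ω => ENNReal.ofReal (Real.exp (r / v * blockEnergy (fun i => X i ω) s t)))
      (hg.comp ((measurable_energy s S).comp hXp)).aemeasurable
      (hg.comp ((measurable_blockEnergy s t).comp hXp)).aemeasurable (hind.comp hg hg),
      ih s hst.1 (hst.2.le.trans htn) fun x hx =>
        ⟨(hS x (Finset.mem_insert_of_mem hx)).1, hs x hx⟩,
      lintegral_exp_blockEnergy hv hX hlaw hindep r hst.2 htn,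
      Finset.card_insert_of_notMem hsS, ← pow_succ]

theorem measure_energy_ge_le [IsProbabilityMeasure P] {n : ℕ} {v : NNReal} (hv : v ≠ 0)
    (hX : ∀ i, Measurable (X i))
    (hlaw : ∀ i ∈ Finset.Icc 1 n, HasLaw (X i) (gaussianReal 0 v) P)
    (hindep : iIndepFun (fun i : Finset.Icc 1 n => X i) P) {r : ℝ} (hr : 0 < r) (hn : 0 < n)
    {S : Finset ℕ} (hS : ∀ s ∈ S, 0 < s ∧ s < n) (x : ℝ) :
    P {ω | v * x ≤ energy (fun i => X i ω) n S} ≤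
      chiSqMoment r ^ (S.card + 1) * ENNReal.ofReal (Real.exp (-(r * x))) := by
  have hXp : Measurable fun ω i => X i ω := measurable_pi_lambda _ hX
  have hv' : (0 : ℝ) < v := by positivity
  have hg : Measurable fun x : ℝ => ENNReal.ofReal (Real.exp (r / v * x)) := by fun_prop
  have h1 := mul_meas_ge_le_lintegral₀ (μ := P)
    (hg.comp ((measurable_energy n S).comp hXp)).aemeasurable (ENNReal.ofReal (Real.exp (r * x)))
  simp only [Function.comp_apply] at h1
  rw [lintegral_exp_energy hv hX hlaw hindep r S n hn le_rfl hS] at h1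
  have h2 : P {ω | v * x ≤ energy (fun i => X i ω) n S} ≤
      P {ω | ENNReal.ofReal (Real.exp (r * x)) ≤
        ENNReal.ofReal (Real.exp (r / v * energy (fun i => X i ω) n S))} := by
    refine measure_mono fun ω hω => ENNReal.ofReal_le_ofReal (Real.exp_le_exp.2 ?_)
    calc r * x = r / v * (v * x) := by field_simp
      _ ≤ _ := mul_le_mul_of_nonneg_left hω (by positivity)
  refine h2.trans ?_
  rw [Real.exp_neg, ENNReal.ofReal_inv_of_pos (Real.exp_pos _), ← div_eq_mul_inv,
    ENNReal.le_div_iff_mul_le (Or.inl (by simp [Real.exp_pos])) (Or.inl ENNReal.ofReal_ne_top),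
    mul_comm]
  exact h1

/-! ### The union bound for bad noise. -/

variable {m : ℕ} {θ : Fin m → ℝ}

/-- Union over companions `W` and over sets `R` of each size `k`. There are at most `2 * m + 1 + k`
blocks, so the uncharged ones cost only the constant `chiSqMoment r ^ (2 * m + 1)`, and the rest
sums geometrically in `k`. -/
theorem measure_not_goodNoise_le [IsProbabilityMeasure P] {n : ℕ} {v : NNReal} (hv : v ≠ 0)
    (hX : ∀ i, Measurable (X i))
    (hlaw : ∀ i ∈ Finset.Icc 1 n, HasLaw (X i) (gaussianReal 0 v) P)
    (hindep : iIndepFun (fun i : Finset.Icc 1 n => X i) P) {r : ℝ} (hr : 0 < r) (hn : 0 < n)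
    (w : ℕ) (x : ℝ) :
    P {ω | ¬ GoodNoise θ n w (v * x) fun i => X i ω} ≤
      (2 * w + 1 : ℕ) ^ m * chiSqMoment r ^ (2 * m + 1) *
        ∑' k : ℕ, (n * chiSqMoment r * ENNReal.ofReal (Real.exp (-(r * x)))) ^ (k + 1) := by
  classical
  set c := chiSqMoment r with hc
  have hc1 : 1 ≤ c := one_le_chiSqMoment hr.le
  set p := ENNReal.ofReal (Real.exp (-(r * x))) with hp
  set WW : Finset (Fin m → ℕ) := Fintype.piFinset fun j =>
    Finset.Icc (changeLoc θ n j - w) (changeLoc θ n j + w) with hWW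
  have hWc : WW.card ≤ (2 * w + 1) ^ m := by
    rw [hWW, Fintype.card_piFinset]
    refine (Finset.prod_le_pow_card _ _ (2 * w + 1) fun j _ => ?_).trans_eq (by simp)
    rw [Nat.card_Icc]
    omega
  set T : (Fin m → ℕ) → Finset ℕ → Finset ℕ := fun W R =>
    trueChanges θ n ∪ Finset.univ.image W ∪ R with hT
  set E : (Fin m → ℕ) → Finset ℕ → Set Ω := fun W R =>
    {ω | (∀ s ∈ T W R, 0 < s ∧ s < n) ∧ R.card * (v * x) ≤ energy (fun i => X i ω) n (T W R)}
    with hE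
  have hEle : ∀ k : ℕ, ∀ W, ∀ R ∈ Finset.powersetCard k (Finset.Icc 1 n),
      P (E W R) ≤ c ^ (2 * m + 1) * (c * p) ^ k := by
    intro k W R hR
    have hRk := (Finset.mem_powersetCard.1 hR).2
    by_cases hb : ∀ s ∈ T W R, 0 < s ∧ s < n
    · have hcard : (T W R).card + 1 ≤ 2 * m + 1 + k := by
        have h1 := Finset.card_union_le (trueChanges θ n ∪ Finset.univ.image W) R
        have h2 := Finset.card_union_le (trueChanges θ n) (Finset.univ.image W)
        have h3 : (trueChanges θ n).card ≤ m := card_trueChanges_le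
        have h4 : (Finset.univ.image W).card ≤ m := Finset.card_image_le.trans_eq (by simp)
        simp only [hT]
        omega
      calc P (E W R) ≤ P {ω | v * (k * x) ≤ energy (fun i => X i ω) n (T W R)} := by
            refine measure_mono fun ω hω => ?_
            have := hω.2
            rw [hRk] at this
            rw [Set.mem_ofPred_eq]
            linarith
        _ ≤ c ^ ((T W R).card + 1) * ENNReal.ofReal (Real.exp (-(r * (k * x)))) :=
            measure_energy_ge_le hv hX hlaw hindep hr hn hb _
        _ = c ^ ((T W R).card + 1) * p ^ k := by
            rw [hp, ← ENNReal.ofReal_pow (Real.exp_pos _).le, ← Real.exp_nat_mul]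
            congr 3
            ring
        -- Coinciding points only lower the number of blocks, and `1 ≤ c`.
        _ ≤ c ^ (2 * m + 1 + k) * p ^ k := by gcongr
        _ = _ := by rw [pow_add, mul_pow, mul_assoc]
    · have : E W R = ∅ := by
        ext ω
        simp only [hE, Set.mem_ofPred_eq, Set.mem_empty_iff_false, iff_false]
        exact fun h => hb h.1
      simp [this]
  have hsub : {ω | ¬ GoodNoise θ n w (v * x) fun i => X i ω} ⊆
      ⋃ k ∈ Finset.Icc 1 n, ⋃ W ∈ WW, ⋃ R ∈ Finset.powersetCard k (Finset.Icc 1 n), E W R := by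
    intro ω hω
    simp only [GoodNoise, Set.mem_ofPred_eq, not_forall, not_lt] at hω
    obtain ⟨W, hW, R, hRne, hb, hle⟩ := hω
    have hRI : R ⊆ Finset.Icc 1 n := fun s hs => by
      have := hb s (Finset.mem_union_right _ hs)
      rw [Finset.mem_Icc]
      omega
    simp only [Set.mem_iUnion]
    refine ⟨R.card, Finset.mem_Icc.2 ⟨Finset.card_pos.2 hRne, ?_⟩, W, ?_, R,
      Finset.mem_powersetCard.2 ⟨hRI, rfl⟩, hb, hle⟩
    · simpa using Finset.card_le_card hRI
    · rw [hWW, Fintype.mem_piFinset]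
      intro j
      have := hW j
      rw [Finset.mem_Icc]
      omega
  calc P {ω | ¬ GoodNoise θ n w (v * x) fun i => X i ω}
      ≤ ∑ k ∈ Finset.Icc 1 n, ∑ W ∈ WW, ∑ R ∈ Finset.powersetCard k (Finset.Icc 1 n),
          P (E W R) :=
        (measure_mono hsub).trans <| (measure_biUnion_finset_le _ _).trans <|
          Finset.sum_le_sum fun k _ => (measure_biUnion_finset_le _ _).trans <|
            Finset.sum_le_sum fun W _ => measure_biUnion_finset_le _ _
    _ ≤ ∑ k ∈ Finset.Icc 1 n, ∑ W ∈ WW, ∑ R ∈ Finset.powersetCard k (Finset.Icc 1 n),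
          c ^ (2 * m + 1) * (c * p) ^ k :=
        Finset.sum_le_sum fun k _ => Finset.sum_le_sum fun W _ => Finset.sum_le_sum fun R hR =>
          hEle k W R hR
    _ ≤ ∑ k ∈ Finset.Icc 1 n, (2 * w + 1 : ℕ) ^ m * c ^ (2 * m + 1) * (n * c * p) ^ k := by
        refine Finset.sum_le_sum fun k _ => ?_
        have hch : ((n.choose k : ℕ) : ℝ≥0∞) ≤ n ^ k := by exact_mod_cast Nat.choose_le_pow n k
        have hWc' : (WW.card : ℝ≥0∞) ≤ (2 * w + 1 : ℕ) ^ m := by exact_mod_cast hWc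
        simp only [Finset.sum_const, nsmul_eq_mul, Finset.card_powersetCard, Nat.card_Icc,
          Nat.add_sub_cancel]
        calc _ ≤ ((2 * w + 1 : ℕ) : ℝ≥0∞) ^ m * (n ^ k * (c ^ (2 * m + 1) * (c * p) ^ k)) := by
              gcongr
          _ = _ := by rw [mul_assoc (n : ℝ≥0∞), mul_pow (n : ℝ≥0∞)]; ring
    _ = (2 * w + 1 : ℕ) ^ m * c ^ (2 * m + 1) * ∑ k ∈ Finset.Icc 1 n, (n * c * p) ^ k := by
        rw [Finset.mul_sum]
    _ ≤ _ := by
        gcongr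
        have hIcc : Finset.Icc 1 n = Finset.Ico 1 (n + 1) := by
          ext
          simp
        rw [hIcc, Finset.sum_Ico_eq_sum_range]
        simp only [add_comm 1]
        exact ENNReal.sum_le_tsum _

theorem GoodNoise.congr {n w : ℕ} {β : ℝ} {z z' : ℕ → ℝ} (h : ∀ i ∈ Finset.Icc 1 n, z i = z' i)
    (hz : GoodNoise θ n w β z) : GoodNoise θ n w β z' := by
  intro W hW R hR hb
  have e := dependsOn_energy (fun s hs => (hb s hs).2) fun i hi => h i (by
    simp only [Finset.coe_Ioc, Set.mem_Ioc] at hi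
    exact Finset.mem_Icc.2 hi)
  exact e.symm.trans_lt (hz W hW R hR hb)

/-- A law gives only almost everywhere measurability, and only for indices in `1, …, n`. Measurable
versions, with `0` at other indices, change the event by a null set. -/
theorem measure_not_goodNoise_le_of_hasLaw [IsProbabilityMeasure P] {n : ℕ} {v : NNReal}
    (hv : v ≠ 0) (hlaw : ∀ i ∈ Finset.Icc 1 n, HasLaw (X i) (gaussianReal 0 v) P)
    (hindep : iIndepFun (fun i : Finset.Icc 1 n => X i) P) {r : ℝ} (hr : 0 < r) (hn : 0 < n)
    (w : ℕ) (x : ℝ) :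
    P {ω | ¬ GoodNoise θ n w (v * x) fun i => X i ω} ≤
      (2 * w + 1 : ℕ) ^ m * chiSqMoment r ^ (2 * m + 1) *
        ∑' k : ℕ, (n * chiSqMoment r * ENNReal.ofReal (Real.exp (-(r * x)))) ^ (k + 1) := by
  have hex : ∀ i, ∃ Y : Ω → ℝ, Measurable Y ∧ (i ∈ Finset.Icc 1 n → X i =ᵐ[P] Y) := by
    intro i
    by_cases hi : i ∈ Finset.Icc 1 n
    · have h := (hlaw i hi).aemeasurable
      exact ⟨h.mk _, h.measurable_mk, fun _ => h.ae_eq_mk⟩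
    · exact ⟨0, measurable_const, fun h => absurd h hi⟩
  choose Y hY hXY using hex
  have hae : ∀ᵐ ω ∂P, ∀ i ∈ Finset.Icc 1 n, X i ω = Y i ω :=
    (Filter.eventually_all_finset _).2 fun i hi => hXY i hi
  have hlaw' : ∀ i ∈ Finset.Icc 1 n, HasLaw (Y i) (gaussianReal 0 v) P :=
    fun i hi => (hlaw i hi).congr (hXY i hi).symm
  have hindep' : iIndepFun (fun i : Finset.Icc 1 n => Y i) P :=
    hindep.congr fun i => hXY i.1 i.2
  refine le_trans (measure_mono_ae ?_)
    (measure_not_goodNoise_le (θ := θ) hv hY hlaw' hindep' hr hn w x)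
  filter_upwards [hae] with ω hω hbad hgood
  exact hbad (hgood.congr fun i hi => (hω i hi).symm)

end Noise

/-! ### Limits as the length grows. -/

section Asymptotics

open scoped ENNReal

variable {m : ℕ} {θ : Fin m → ℝ}

theorem tendsto_log_natCast : Tendsto (fun n : ℕ => Real.log n) atTop atTop :=
  Real.tendsto_log_atTop.comp tendsto_natCast_atTop_atTop

theorem eventually_wellSpaced (hθ : StrictMono θ) (hθ01 : ∀ j, θ j ∈ Set.Ioo (0 : ℝ) 1)
    {L : ℕ → ℕ} (hLo : (fun n => (L n : ℝ)) =o[atTop] (fun n : ℕ => (n : ℝ))) :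
    ∀ᶠ n in atTop, WellSpaced θ n (L n) := by
  -- The summand `2` absorbs the rounding of the true changepoints.
  have key : ∀ κ : ℝ, 0 < κ → ∀ᶠ n : ℕ in atTop, 2 * (L n : ℝ) + 2 ≤ κ * n := by
    intro κ hκ
    filter_upwards [hLo.def (c := κ / 4) (by positivity),
      tendsto_natCast_atTop_atTop.eventually_ge_atTop (4 / κ)] with n h1 h2
    simp only [Real.norm_natCast] at h1
    rw [div_le_iff₀ hκ] at h2
    linarith
  have e1 : ∀ᶠ n : ℕ in atTop, ∀ j, 2 * (L n : ℝ) + 2 ≤ θ j * n :=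
    eventually_all.2 fun j => key _ (hθ01 j).1
  have e2 : ∀ᶠ n : ℕ in atTop, ∀ j, 2 * (L n : ℝ) + 2 ≤ (1 - θ j) * n :=
    eventually_all.2 fun j => key _ (sub_pos.2 (hθ01 j).2)
  have e3 : ∀ᶠ n : ℕ in atTop, ∀ j k, j < k → 2 * (L n : ℝ) + 2 ≤ (θ k - θ j) * n :=
    eventually_all.2 fun j => eventually_all.2 fun k => by
      by_cases hjk : j < k
      · filter_upwards [key _ (sub_pos.2 (hθ hjk))] with n hn _ using hn
      · exact Eventually.of_forall fun n h => absurd h hjk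
  filter_upwards [e1, e2, e3] with n h1 h2 h3
  have hfl : ∀ j, (changeLoc θ n j : ℝ) ≤ θ j * n := fun j =>
    Nat.floor_le (mul_nonneg (hθ01 j).1.le (Nat.cast_nonneg n))
  have hfu : ∀ j, θ j * n < changeLoc θ n j + 1 := fun j => Nat.lt_floor_add_one _
  have hL0 : (0 : ℝ) ≤ L n := Nat.cast_nonneg _
  refine ⟨fun j => ?_, fun j => ?_, fun j k hjk => ?_⟩
  · have : (L n : ℝ) < changeLoc θ n j := by linarith [h1 j, hfu j]
    exact_mod_cast this
  · have : (changeLoc θ n j : ℝ) + L n < n := by linarith [h2 j, hfl j]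
    exact_mod_cast this
  · have : (changeLoc θ n j : ℝ) + 2 * L n < changeLoc θ n k := by
      linarith [h3 j k hjk, hfl j, hfu k]
    exact_mod_cast this

theorem exists_pos_le_abs_sub {μ : Fin (m + 1) → ℝ} (hμ : ∀ k : Fin m, μ k.castSucc ≠ μ k.succ) :
    ∃ δ : ℝ, 0 < δ ∧ ∀ k : Fin m, δ ≤ |μ k.castSucc - μ k.succ| := by
  rcases isEmpty_or_nonempty (Fin m) with h | h
  · exact ⟨1, one_pos, fun k => h.elim k⟩
  · obtain ⟨k, hk⟩ := Finite.exists_min fun k : Fin m => |μ k.castSucc - μ k.succ|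
    exact ⟨_, abs_pos.2 (sub_ne_zero.2 (hμ k)), hk⟩

theorem eventually_lt_ceil_log_rpow {α δ : ℝ} (hα : 0 < α) (hδ : 0 < δ) (K : ℝ) :
    ∀ᶠ n : ℕ in atTop, K * Real.log n < (⌈Real.log n ^ (1 + α)⌉₊ : ℝ) * δ := by
  filter_upwards [((tendsto_rpow_atTop hα).comp tendsto_log_natCast).eventually_gt_atTop (K / δ),
    tendsto_log_natCast.eventually_gt_atTop 0] with n h1 h2
  simp only [Function.comp_apply] at h1
  rw [div_lt_iff₀ hδ] at h1
  calc K * Real.log n < Real.log n ^ α * δ * Real.log n := mul_lt_mul_of_pos_right h1 h2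
    _ = Real.log n ^ (1 + α) * δ := by rw [Real.rpow_add h2, Real.rpow_one]; ring
    _ ≤ _ := mul_le_mul_of_nonneg_right (Nat.le_ceil _) hδ.le

theorem tendsto_window_pow_mul_rpow (m : ℕ) {α s : ℝ} (hα : 0 < α) (hs : 0 < s) :
    Tendsto (fun n : ℕ => ((2 * ⌈Real.log n ^ (1 + α)⌉₊ + 1 : ℕ) : ℝ) ^ m * (n : ℝ) ^ (-s)) atTop
      (𝓝 0) := by
  have h1 : Tendsto (fun n : ℕ => 5 ^ m * (Real.log n ^ ((1 + α) * m) / (n : ℝ) ^ s)) atTop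
      (𝓝 (5 ^ m * 0)) :=
    (((isLittleO_log_rpow_rpow_atTop ((1 + α) * m) hs).tendsto_div_nhds_zero).comp
      tendsto_natCast_atTop_atTop).const_mul _
  rw [mul_zero] at h1
  refine squeeze_zero' (Eventually.of_forall fun n => by positivity) ?_ h1
  filter_upwards [tendsto_log_natCast.eventually_ge_atTop 1] with n h2
  have h3 : 1 ≤ Real.log n ^ (1 + α) := Real.one_le_rpow h2 (by linarith)
  have h4 := (Nat.ceil_lt_add_one (zero_le_one.trans h3)).le
  have h5 : ((2 * ⌈Real.log n ^ (1 + α)⌉₊ + 1 : ℕ) : ℝ) ≤ 5 * Real.log n ^ (1 + α) := by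
    push_cast
    linarith
  calc _ ≤ (5 * Real.log n ^ (1 + α)) ^ m * (n : ℝ) ^ (-s) := by gcongr
    _ = _ := by
      rw [mul_pow, ← Real.rpow_mul_natCast (by linarith), Real.rpow_neg (Nat.cast_nonneg n)]
      ring

/-- The geometric ratio is `c * n ^ (-(ε / 4))`, so the series is of the order of its first term,
which beats the power of `log n` from the companions. -/
theorem tendsto_noise_bound (m : ℕ) {α ε : ℝ} (hα : 0 < α) (hε : 0 < ε) {c : ℝ≥0∞}
    (hc : c < ∞) {r : ℝ} (hr : r * (2 + ε) = 1 + ε / 4) :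
    Tendsto (fun n : ℕ => ((2 * ⌈Real.log n ^ (1 + α)⌉₊ + 1 : ℕ) : ℝ≥0∞) ^ m * c ^ (2 * m + 1) *
        ∑' k : ℕ, (n * c * ENNReal.ofReal (Real.exp (-(r * ((2 + ε) * Real.log n))))) ^ (k + 1))
      atTop (𝓝 0) := by
  have hp : ∀ n : ℕ, 0 < n → (n : ℝ≥0∞) * c *
      ENNReal.ofReal (Real.exp (-(r * ((2 + ε) * Real.log n)))) =
        c * ENNReal.ofReal ((n : ℝ) ^ (-(ε / 4))) := by
    intro n hn
    have hn' : (0 : ℝ) < n := by exact_mod_cast hn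
    rw [mul_comm (n : ℝ≥0∞), mul_assoc, ← ENNReal.ofReal_natCast, ← ENNReal.ofReal_mul hn'.le]
    congr 2
    rw [← mul_assoc, hr, Real.rpow_def_of_pos hn']
    nth_rw 1 [← Real.exp_log hn']
    rw [← Real.exp_add]
    congr 1
    ring
  have hq : Tendsto (fun n : ℕ => c * ENNReal.ofReal ((n : ℝ) ^ (-(ε / 4)))) atTop (𝓝 0) := by
    have h1 : Tendsto (fun n : ℕ => (n : ℝ) ^ (-(ε / 4))) atTop (𝓝 0) :=
      (tendsto_rpow_neg_atTop (by positivity)).comp tendsto_natCast_atTop_atTop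
    simpa using ENNReal.Tendsto.const_mul (ENNReal.tendsto_ofReal h1) (Or.inr hc.ne)
  have hinv : Tendsto (fun n : ℕ => (1 - c * ENNReal.ofReal ((n : ℝ) ^ (-(ε / 4))))⁻¹) atTop
      (𝓝 1) := by
    have h1 := ENNReal.Tendsto.sub (tendsto_const_nhds (x := (1 : ℝ≥0∞))) hq
      (Or.inl ENNReal.one_ne_top)
    simpa using tendsto_inv_iff.2 h1
  have hw : Tendsto (fun n : ℕ => ENNReal.ofReal
      (((2 * ⌈Real.log n ^ (1 + α)⌉₊ + 1 : ℕ) : ℝ) ^ m * (n : ℝ) ^ (-(ε / 4)))) atTop (𝓝 0) := by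
    simpa using ENNReal.tendsto_ofReal
      (tendsto_window_pow_mul_rpow m hα (s := ε / 4) (by positivity))
  have hfin := ENNReal.Tendsto.mul
    (ENNReal.Tendsto.const_mul (a := c ^ (2 * m + 2)) hw (Or.inr (ENNReal.pow_ne_top hc.ne)))
    (Or.inr ENNReal.one_ne_top) hinv (Or.inl one_ne_zero)
  rw [mul_zero, zero_mul] at hfin
  refine hfin.congr' ?_
  filter_upwards [eventually_gt_atTop 0] with n hn
  rw [hp n hn, ENNReal.tsum_geometric_add_one, ENNReal.ofReal_mul (by positivity),
    ENNReal.ofReal_pow (Nat.cast_nonneg _), ENNReal.ofReal_natCast]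
  ring

end Asymptotics

end Changepoint

/-! ### The main theorem. -/

theorem theorem2
    -- the true changepoint proportions and the means of the segments
    {m : ℕ} (θ : Fin m → ℝ) (hθ : StrictMono θ) (hθ01 : ∀ j, θ j ∈ Set.Ioo (0 : ℝ) 1)
    (μ : Fin (m + 1) → ℝ) (hμ : ∀ k : Fin m, μ k.castSucc ≠ μ k.succ)
    -- for each length, independent centred Gaussian noise with variance `v`
    (v : NNReal) (hv : v ≠ 0)
    {Ω : ℕ → Type*} [∀ n, MeasurableSpace (Ω n)] (P : ∀ n, Measure (Ω n))
    [∀ n, IsProbabilityMeasure (P n)]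
    (noise : ∀ n, ℕ → Ω n → ℝ)
    (hlaw : ∀ n, ∀ i ∈ Finset.Icc 1 n, HasLaw (noise n i) (gaussianReal 0 v) (P n))
    (hindep : ∀ n, iIndepFun (fun i : Finset.Icc 1 n => noise n i) (P n))
    (ε : ℝ) (hε : 0 < ε) (α : ℝ) (hα : 0 < α)
    -- the numbers of cores
    (L : ℕ → ℕ) (hLo : (fun n => (L n : ℝ)) =o[atTop] (fun n : ℕ => (n : ℝ)))
    (hL : ∀ᶠ n : ℕ in atTop, ⌈Real.log n ^ (1 + α)⌉₊ ≤ L n) :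
    Tendsto
      (fun n => P n {ω | ∀ S : Finset ℕ,
        Changepoint.IsDealOutput
          (Changepoint.changeInMean θ μ n (fun i => noise n i ω)) n (L n)
          ((2 + ε) * v * Real.log n) S →
        Changepoint.Accurate θ α n S})
      atTop (𝓝 1) := by
  obtain ⟨δ, hδ, hδμ⟩ := Changepoint.exists_pos_le_abs_sub hμ
  have hv' : (0 : ℝ) < v := by positivity
  -- The midpoint: above `1 / (2 + ε)` to beat the union bound, below `1 / 2` for a finite
  -- exponential moment.
  set r : ℝ := (1 / (2 + ε) + 1 / 2) / 2 with hrdef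
  have hr0 : 0 < r := by positivity
  have hr : r * (2 + ε) = 1 + ε / 4 := by
    rw [hrdef]
    field_simp
    ring
  have hr2 : r < 1 / 2 := by nlinarith
  have hb := Changepoint.tendsto_noise_bound m hα hε (Changepoint.chiSqMoment_lt_top hr2) hr
  have hlim := ENNReal.Tendsto.sub (tendsto_const_nhds (x := (1 : ENNReal))) hb
    (Or.inl ENNReal.one_ne_top)
  rw [tsub_zero] at hlim
  refine tendsto_of_tendsto_of_tendsto_of_le_of_le' hlim tendsto_const_nhds ?_
    (Eventually.of_forall fun n => prob_le_one)
  filter_upwards [hL, Changepoint.eventually_wellSpaced hθ hθ01 hLo,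
    Changepoint.eventually_lt_ceil_log_rpow hα (δ := δ ^ 2 / 4) (by positivity)
      ((m + 5) * ((2 + ε) * v)),
    Changepoint.tendsto_log_natCast.eventually_gt_atTop 0, eventually_gt_atTop 0]
    with n hLn hsp hbig hlog hn
  rw [tsub_le_iff_right]
  have hβ : (2 + ε) * v * Real.log n = v * ((2 + ε) * Real.log n) := by ring
  have hw : 0 < ⌈Real.log n ^ (1 + α)⌉₊ := Nat.ceil_pos.2 (Real.rpow_pos_of_pos hlog _)
  refine le_trans ?_ (add_le_add le_rfl (Changepoint.measure_not_goodNoise_le_of_hasLaw (θ := θ) hv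
    (hlaw n) (hindep n) hr0 hn ⌈Real.log n ^ (1 + α)⌉₊ ((2 + ε) * Real.log n)))
  -- Covering the whole space by the target event and bad noise needs only subadditivity, so no
  -- measurability of either event is required.
  refine (measure_univ (μ := P n)).symm.trans_le
    ((measure_mono fun ω _ => ?_).trans (measure_union_le _ _))
  by_cases hg : Changepoint.GoodNoise θ n ⌈Real.log n ^ (1 + α)⌉₊
    (v * ((2 + ε) * Real.log n)) fun i => noise n i ω
  · refine Or.inl fun S hS => ?_
    rw [hβ] at hS
    refine Changepoint.accurate_of_isDealOutput (by positivity) hsp hw hLn hg hδ.le hδμ ?_ hS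
    linarith
  · exact Or.inr hg
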